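/- A conference matrix of order $n$ is an $n\times n$ matrix $W$ with entries in $\{0,1,-1\}$ and zero diagonal such that $WW^T=(n-1)I$; its excess $E(W)$ is the sum of all its entries. Let $q=p^r=4m^2+1$, where $p$ is a prime with $p\equiv 1\pmod 4$, $r\ge 1$, and $m$ is a nonnegative integer. Then $q$ is not a square, and there is a conference matrix $W$ of order $n=q+1$ such that: (a) $W$ has the maximum excess: $E(V)\le E(W)$ for every conference matrix $V$ of order $q+1$; (b) $$E(W)=\frac{n(k^2+2k+n-1)}{2(k+1)},$$ where $k$ is the odd integer with $k\le\sqrt{n-1}<k+2$; (c) the set of entries of the vector $W\mathbf 1_{q+1}$ (the row sums of $W$) is exactly $\{2m-1,2m+1\}$. -/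

import Mathlib

/-- An `n × n` integer matrix is a *conference matrix of order `n`* if its entries are
`0`, `1` or `-1`, its diagonal is zero and `W Wᵀ = (n - 1) I`. -/
structure IsConferenceMatrix {n : ℕ} (W : Matrix (Fin n) (Fin n) ℤ) : Prop where
  entries : ∀ i j, W i j = 0 ∨ W i j = 1 ∨ W i j = -1
  diag : ∀ i, W i i = 0
  mul_transpose : W * W.transpose = ((n : ℤ) - 1) • (1 : Matrix (Fin n) (Fin n) ℤ)

/-- The *excess* of a matrix: the sum of all its entries. -/
def excess {n : ℕ} (W : Matrix (Fin n) (Fin n) ℤ) : ℤ :=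
  ∑ i, ∑ j, W i j

/-! Upper bound: the row sums of a conference matrix are odd and their squares add up to `n(n-1)`.
An odd number is at distance at least 1 from `2m`, so summing `(r_i - 2m)^2 ≥ 1` gives excess at
most `2mn`, attained when all row sums are `2m ± 1`.

Construction: negate rows and columns of the Paley matrix `C` on the projective line. Let `ψ` be a
quartic character, `g` a nonsquare, and `v` the vector of values of `ψ(x² - g y²)`. Multiplicativity
of the norm form gives `C v = E v³ = E v̄`, with `E` a character sum
(`one_add_sum_quadraticChar_mul`). Orthogonality of `C` forces `|E|² = q`, and reduction mod `p`
shows `p ∤ E` (`not_dvd_normFormSum`), so `E` has coordinates `±2m` and `±1` in some order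
(`eq_of_sq_add_sq_eq_prime_pow`). Then `y = Re v + Im v` is a sign vector and the entries of `C y`
are `±2m ± 1`; scaling columns by `y` and rows by suitable signs finishes. -/

theorem sum_sq_mulVec_of_transpose_mul {ι : Type*} [Fintype ι] [DecidableEq ι]
    {A : Matrix ι ι ℤ} {q : ℤ} (h : A.transpose * A = q • (1 : Matrix ι ι ℤ)) (v : ι → ℤ) :
    ∑ i, (A.mulVec v i) ^ 2 = q * ∑ i, v i ^ 2 := by
  have h1 : A.mulVec v ⬝ᵥ A.mulVec v = q * (v ⬝ᵥ v) := by
    rw [Matrix.dotProduct_mulVec, ← Matrix.mulVec_transpose, Matrix.mulVec_mulVec, h,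
      Matrix.smul_mulVec, Matrix.one_mulVec, smul_dotProduct, smul_eq_mul]
  simpa [dotProduct, pow_two] using h1

theorem transpose_mul_self_of_mul_transpose {ι : Type*} [Fintype ι] [DecidableEq ι]
    {A : Matrix ι ι ℤ} {q : ℤ} (hq : q ≠ 0) (h : A * A.transpose = q • (1 : Matrix ι ι ℤ)) :
    A.transpose * A = q • (1 : Matrix ι ι ℤ) := by
  have hdet : A.det ≠ 0 := by
    intro h0
    have := congrArg Matrix.det h
    rw [Matrix.det_mul, h0, zero_mul, Matrix.det_smul, Matrix.det_one, mul_one] at this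
    exact pow_ne_zero _ hq this.symm
  have h1 : A * (A.transpose * A - q • (1 : Matrix ι ι ℤ)) = 0 := by
    rw [mul_sub, ← mul_assoc, h, Matrix.smul_mul, Matrix.mul_smul, one_mul, mul_one, sub_self]
  have h2 : A.det • (A.transpose * A - q • (1 : Matrix ι ι ℤ)) = 0 := by
    have := congrArg (A.adjugate * ·) h1
    simpa only [← mul_assoc, Matrix.adjugate_mul, Matrix.mul_zero, Matrix.smul_mul,
      Matrix.one_mul] using this
  exact sub_eq_zero.mp ((smul_eq_zero.mp h2).resolve_left hdet)

/-! ### The Paley matrix and its action on quartic character values -/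

section Paley

variable {F : Type*} [Field F] [Fintype F] [DecidableEq F]

/-- The substitution `e = c - (c - d) t` turns the sum into `χ(-1)` times the Jacobi sum `J(χ, χ⁻¹)
= -χ(-1)`. -/
theorem sum_quadraticChar_sub_mul_sub (hF : ringChar F ≠ 2) {c d : F} (hcd : c ≠ d) :
    ∑ e, quadraticChar F (c - e) * quadraticChar F (d - e) = -1 := by
  have h0 : c - d ≠ 0 := sub_ne_zero.mpr hcd
  have hJ := jacobiSum_nontrivial_inv (quadraticChar_ne_one hF)
  rw [(quadraticChar_isQuadratic (F := F)).inv, jacobiSum] at hJ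
  have hs : ∀ a : F, a ≠ 0 → quadraticChar F a * quadraticChar F a = 1 := fun a ha => by
    rw [← pow_two, quadraticChar_sq_one ha]
  have key : ∑ e, quadraticChar F (c - e) * quadraticChar F (d - e) =
      ∑ t, quadraticChar F (-1) * (quadraticChar F t * quadraticChar F (1 - t)) := by
    refine (Fintype.sum_equiv ((Equiv.mulLeft₀ (c - d) h0).trans (Equiv.subLeft c)) _ _ ?_).symm
    intro t
    have e1 : c - (c - (c - d) * t) = (c - d) * t := by ring
    have e2 : d - (c - (c - d) * t) = (c - d) * (-1 * (1 - t)) := by ring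
    simp only [Equiv.trans_apply, Equiv.mulLeft₀_apply, Equiv.subLeft_apply, e1, e2, map_mul]
    linear_combination (-(quadraticChar F (-1) * quadraticChar F t * quadraticChar F (1 - t))) *
      hs _ h0
  rw [key, ← Finset.mul_sum, hJ, mul_neg, hs _ (neg_ne_zero.mpr one_ne_zero)]

/-- The Paley conference matrix on the projective line over `F`. -/
def paleyConference (F : Type*) [Field F] [Fintype F] [DecidableEq F] :
    Matrix (Option F) (Option F) ℤ
  | none, none => 0
  | none, some _ => 1
  | some _, none => 1
  | some c, some d => quadraticChar F (c - d)

theorem paleyConference_entries (i j : Option F) : paleyConference F i j = 0 ∨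
    paleyConference F i j = 1 ∨ paleyConference F i j = -1 := by
  rcases i with _ | c <;> rcases j with _ | d
  · exact Or.inl rfl
  · exact Or.inr (Or.inl rfl)
  · exact Or.inr (Or.inl rfl)
  · exact quadraticChar_isQuadratic (F := F) (c - d)

theorem paleyConference_diag (i : Option F) : paleyConference F i i = 0 := by
  rcases i with _ | c <;> simp [paleyConference]

theorem paleyConference_mul_transpose (hF : ringChar F ≠ 2) :
    paleyConference F * (paleyConference F).transpose =
      (Fintype.card F : ℤ) • (1 : Matrix (Option F) (Option F) ℤ) := by
  have hsum : ∀ c : F, ∑ e, quadraticChar F (c - e) = 0 := fun c =>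
    (Fintype.sum_equiv (Equiv.subLeft c) _ _ fun _ => rfl).trans (quadraticChar_sum_zero hF)
  have hsq : ∀ c : F, ∑ e, quadraticChar F (c - e) * quadraticChar F (c - e) =
      (Fintype.card F : ℤ) - 1 := fun c => by
    rw [Fintype.sum_equiv (Equiv.subLeft c)
      (fun e => quadraticChar F (c - e) * quadraticChar F (c - e))
      (fun t => quadraticChar F t * quadraticChar F t) fun _ => rfl, ← Finset.add_sum_erase _ _ (Finset.mem_univ (0 : F)),
      Finset.sum_congr rfl (g := fun _ => (1 : ℤ))]
    · simp [Finset.card_erase_of_mem, Nat.cast_sub Fintype.card_pos]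
    · intro x hx
      rw [← pow_two, quadraticChar_sq_one (Finset.ne_of_mem_erase hx)]
  ext i j
  rcases i with _ | c <;> rcases j with _ | d
  · simp [-quadraticChar_apply, Matrix.mul_apply, paleyConference]
  · simp [-quadraticChar_apply, Matrix.mul_apply, paleyConference, hsum]
  · simp [-quadraticChar_apply, Matrix.mul_apply, paleyConference, hsum]
  · by_cases hcd : c = d
    · subst hcd
      simp [-quadraticChar_apply, Matrix.mul_apply, paleyConference, hsq]
    · simp [-quadraticChar_apply, Matrix.mul_apply, paleyConference, sum_quadraticChar_sub_mul_sub hF hcd, hcd]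

/-- The Eisenstein-type sum attached to a character and a nonsquare. -/
def normFormSum (ψ : MulChar F GaussianInt) (g : F) : GaussianInt := ∑ t, ψ (t ^ 2 - g)

theorem sq_sub_ne_zero {K : Type*} [Field K] {g : K} (hg : ¬ IsSquare g) (x : K) : x ^ 2 - g ≠ 0 := fun h =>
  hg ⟨x, by linear_combination -h⟩

/-- Up to sign, `(x + √g)(c - √g)` has coordinates `g - xc` and `c - x`; their ratio `t` satisfies
`(x - c)²(t² - g) = (x² - g)(c² - g)`. Applying `ψ` matches the two sums term by term. -/
theorem one_add_sum_quadraticChar_mul {ψ : MulChar F GaussianInt}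
    (hψ : ∀ x, ψ x ^ 2 = ((quadraticChar F x : ℤ) : GaussianInt)) {g : F} (hg : ¬ IsSquare g)
    (x : F) :
    1 + ∑ c, ((quadraticChar F (x - c) : ℤ) : GaussianInt) * ψ (c ^ 2 - g) =
      ψ (x ^ 2 - g) ^ 3 * normFormSum ψ g := by
  have hx := sq_sub_ne_zero hg x
  have h4 : ∀ a : F, a ≠ 0 → ψ a ^ 4 = 1 := fun a ha => by
    rw [show 4 = 2 * 2 from rfl, pow_mul, hψ, ← Int.cast_pow, quadraticChar_sq_one ha,
      Int.cast_one]
  -- The term `c = x` vanishes, and the leading 1 (the point at infinity) is the term `t = -x`,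
  -- since `ψ(x² - g)⁴ = 1`.
  rw [normFormSum, Finset.mul_sum, ← Finset.add_sum_erase _ _ (Finset.mem_univ x),
    ← Finset.add_sum_erase (a := -x) _ _ (Finset.mem_univ _), sub_self, quadraticChar_zero,
    Int.cast_zero, zero_mul, zero_add, neg_sq, ← pow_succ, h4 _ hx]
  congr 1
  refine Finset.sum_nbij' (fun c => (g - x ^ 2) / (c - x) - x) (fun t => (g - x ^ 2) / (t + x) + x)
    ?_ ?_ ?_ ?_ ?_
  · intro c hc
    have hc' : c - x ≠ 0 := sub_ne_zero.mpr (Finset.ne_of_mem_erase hc)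
    have : g - x ^ 2 ≠ 0 := by rwa [← neg_sub, neg_ne_zero]
    simp [sub_eq_iff_eq_add, this, hc']
  · intro t ht
    have ht' : t + x ≠ 0 := fun h => Finset.ne_of_mem_erase ht (eq_neg_of_add_eq_zero_left h)
    have : g - x ^ 2 ≠ 0 := by rwa [← neg_sub, neg_ne_zero]
    simp [this, ht']
  · intro c hc
    have hc' : c - x ≠ 0 := sub_ne_zero.mpr (Finset.ne_of_mem_erase hc)
    have : g - x ^ 2 ≠ 0 := by rwa [← neg_sub, neg_ne_zero]
    simp only [sub_add_cancel, div_div_cancel₀ this]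
  · intro t ht
    have ht' : t + x ≠ 0 := fun h => Finset.ne_of_mem_erase ht (eq_neg_of_add_eq_zero_left h)
    have : g - x ^ 2 ≠ 0 := by rwa [← neg_sub, neg_ne_zero]
    simp only [add_sub_cancel_right, div_div_cancel₀ this]
  · intro c hc
    have hc' : x - c ≠ 0 := sub_ne_zero.mpr (Finset.ne_of_mem_erase hc).symm
    have hc'' : c - x ≠ 0 := sub_ne_zero.mpr (Finset.ne_of_mem_erase hc)
    have e : (x - c) ^ 2 * (((g - x ^ 2) / (c - x) - x) ^ 2 - g) =
        (x ^ 2 - g) * (c ^ 2 - g) := by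
      field_simp
      ring
    have e' := congrArg ψ e
    rw [map_mul, map_mul, map_pow, hψ] at e'
    have hs : ((quadraticChar F (x - c) : ℤ) : GaussianInt) ^ 2 = 1 := by
      rw [← Int.cast_pow, quadraticChar_sq_one hc', Int.cast_one]
    linear_combination
      -(((quadraticChar F (x - c) : ℤ) : GaussianInt) * ψ (x ^ 2 - g) ^ 3) * e' -
      ((quadraticChar F (x - c) : ℤ) : GaussianInt) * ψ (c ^ 2 - g) * h4 _ hx +
      ψ (x ^ 2 - g) ^ 3 * ψ (((g - x ^ 2) / (c - x) - x) ^ 2 - g) * hs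

end Paley

/-! ### Arithmetic modulo p and sums of two squares -/

theorem sub_one_div_four_pow_succ {p : ℕ} (hp4 : p % 4 = 1) (r : ℕ) :
    (p ^ (r + 1) - 1) / 4 = p * ((p ^ r - 1) / 4) + (p - 1) / 4 := by
  obtain ⟨a, ha⟩ : ∃ a, p = 4 * a + 1 := ⟨p / 4, by omega⟩
  have h : p ^ r % 4 = 1 := by simp [Nat.pow_mod, hp4]
  obtain ⟨b, hb⟩ : ∃ b, p ^ r = 4 * b + 1 := ⟨p ^ r / 4, by omega⟩
  rw [pow_succ, hb, ha]
  have : (4 * b + 1) * (4 * a + 1) = 4 * ((4 * a + 1) * b + a) + 1 := by ring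
  rw [this]
  simp

/-- All base-`p` digits of `(p^r - 1)/4` equal `a = (p - 1)/4`. As `3a < p`, tripling and doubling
produce no carries, and Lucas' theorem reduces to `C(3a, 2a)`, which divides `(3a)!`. -/
theorem not_dvd_choose_three_mul_sub_one_div_four {p : ℕ} (hp : p.Prime) (hp4 : p % 4 = 1)
    (r : ℕ) : ¬ p ∣ (3 * ((p ^ r - 1) / 4)).choose (2 * ((p ^ r - 1) / 4)) := by
  have := Fact.mk hp
  induction r with
  | zero => simpa using hp.one_lt.ne'
  | succ r ih =>
    have h2 := hp.two_le
    rw [sub_one_div_four_pow_succ hp4 r]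
    set k := (p ^ r - 1) / 4
    set a := (p - 1) / 4 with ha
    have h := Choose.choose_modEq_choose_mod_mul_choose_div_nat (n := 3 * (p * k + a))
      (k := 2 * (p * k + a)) (p := p)
    have h3 : 3 * (p * k + a) = 3 * a + p * (3 * k) := by ring
    have h4 : 2 * (p * k + a) = 2 * a + p * (2 * k) := by ring
    rw [h3, h4, Nat.add_mul_mod_self_left, Nat.add_mul_mod_self_left,
      Nat.add_mul_div_left _ _ hp.pos, Nat.add_mul_div_left _ _ hp.pos,
      Nat.mod_eq_of_lt (a := 3 * a) (by omega), Nat.mod_eq_of_lt (a := 2 * a) (by omega),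
      Nat.div_eq_of_lt (a := 3 * a) (by omega), Nat.div_eq_of_lt (a := 2 * a) (by omega),
      zero_add, zero_add] at h
    rw [h3, h4, h.dvd_iff dvd_rfl, hp.dvd_mul, not_or]
    refine ⟨fun hd => ?_, ih⟩
    have hf : p ∣ (3 * a).factorial := by
      rw [← Nat.choose_mul_factorial_mul_factorial (n := 3 * a) (k := 2 * a) (by omega), mul_assoc]
      exact hd.mul_right _
    have := hp.dvd_factorial.mp hf
    omega

theorem FiniteField.sum_pow_eq {F : Type*} [Field F] [Fintype F] {i : ℕ} (hi : i ≠ 0) :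
    ∑ x : F, x ^ i = if Fintype.card F - 1 ∣ i then -1 else 0 := by
  classical
  rw [← FiniteField.sum_pow_units F i, ← Finset.add_sum_erase _ _ (Finset.mem_univ (0 : F)),
    zero_pow hi, zero_add]
  symm
  refine Finset.sum_bij (fun x _ => (x : F)) (by simp) (by simp [Units.ext_iff]) ?_ (by simp)
  intro b hb
  exact ⟨Units.mk0 b (Finset.ne_of_mem_erase hb), by simp, rfl⟩

/-- In the binomial expansion the exponents of `c` are `2i ≤ 6k`; only `2i = 4k = q - 1` is a
positive multiple of `q - 1`, and `i = 0` contributes `q = 0`. -/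
theorem sum_sq_add_pow_eq {F : Type*} [Field F] [Fintype F] {k : ℕ} (hk : 0 < k)
    (hcard : Fintype.card F = 4 * k + 1) (a : F) :
    ∑ c : F, (c ^ 2 + a) ^ (3 * k) = -(a ^ k * ((3 * k).choose (2 * k) : F)) := by
  simp_rw [add_pow]
  rw [Finset.sum_comm, Finset.sum_eq_single (2 * k)]
  · rw [← Finset.sum_mul, ← Finset.sum_mul]
    simp_rw [← pow_mul]
    rw [FiniteField.sum_pow_eq (by omega), if_pos (by rw [hcard]; exact ⟨1, by omega⟩),
      show 3 * k - 2 * k = k by omega]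
    ring
  · intro i hi hne
    rw [Finset.mem_range] at hi
    rw [← Finset.sum_mul, ← Finset.sum_mul]
    simp_rw [← pow_mul]
    rcases Nat.eq_zero_or_pos i with rfl | hpos
    · simp
    · rw [FiniteField.sum_pow_eq (by omega), if_neg, zero_mul, zero_mul]
      rw [hcard, Nat.add_sub_cancel]
      rintro ⟨t, ht⟩
      have h1 : t < 2 := by
        by_contra h
        have : 4 * k * 2 ≤ 4 * k * t := Nat.mul_le_mul_left _ (by omega)
        omega
      interval_cases t <;> omega
  · intro h
    simp at h
    omega

/-- An elementary form of unique factorization in `ℤ[i]`: a primitive element of norm `p^r` is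
determined up to units and conjugation. -/
theorem eq_of_sq_add_sq_eq_prime_pow {p r : ℕ} (hp : p.Prime) (hp2 : p ≠ 2) {a b A : ℤ}
    (hA : A ^ 2 + 1 = (p : ℤ) ^ r) (hab : a ^ 2 + b ^ 2 = (p : ℤ) ^ r)
    (h : ¬ ((p : ℤ) ∣ a ∧ (p : ℤ) ∣ b)) :
    (a ^ 2 = A ^ 2 ∧ b ^ 2 = 1) ∨ (a ^ 2 = 1 ∧ b ^ 2 = A ^ 2) := by
  have hpi : Prime (p : ℤ) := Nat.prime_iff_prime_int.mp hp
  set q : ℤ := (p : ℤ) ^ r with hq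
  have hq0 : 0 < q := pow_pos (by exact_mod_cast hp.pos) r
  rcases Nat.eq_zero_or_pos r with rfl | hr
  · simp only [pow_zero] at hq
    have : A ^ 2 = 0 := by omega
    have ha := sq_nonneg a
    have hb := sq_nonneg b
    omega
  have hpq : (p : ℤ) ∣ q := dvd_pow_self _ hr.ne'
  have hprod : q ∣ (a - b * A) * (a + b * A) := ⟨1 - b ^ 2, by linear_combination hab - b ^ 2 * hA⟩
  have hcases : q ∣ a - b * A ∨ q ∣ a + b * A := by
    by_cases h1 : (p : ℤ) ∣ a - b * A
    · by_cases h2 : (p : ℤ) ∣ a + b * A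
      · exfalso
        have h2a : (p : ℤ) ∣ 2 * a := by
          have := dvd_add h1 h2
          ring_nf at this ⊢
          exact this
        have hpa : (p : ℤ) ∣ a := (hpi.dvd_or_dvd h2a).resolve_left fun h2' => hp2
          ((Nat.prime_dvd_prime_iff_eq hp Nat.prime_two).mp (by exact_mod_cast h2'))
        refine h ⟨hpa, hpi.dvd_of_dvd_pow (n := 2) ?_⟩
        rw [← dvd_add_right (dvd_pow hpa two_ne_zero), hab]
        exact hpq
      · exact Or.inl ((IsCoprime.pow_left ((hpi.coprime_iff_not_dvd).mpr h2)).dvd_of_dvd_mul_right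
          hprod)
    · exact Or.inr ((IsCoprime.pow_left ((hpi.coprime_iff_not_dvd).mpr h1)).dvd_of_dvd_mul_left
          hprod)
  have main : ∀ s : ℤ, q ∣ a - s * A → s ^ 2 = b ^ 2 →
      (a ^ 2 = A ^ 2 ∧ b ^ 2 = 1) ∨ (a ^ 2 = 1 ∧ b ^ 2 = A ^ 2) := by
    rintro s ⟨t, ht⟩ hs
    -- Brahmagupta's identity for `(a² + s²)(A² + 1)`; it leaves only `t = 0` or `t² = 1`.
    have hnorm : (q * t) ^ 2 + (a * A + s) ^ 2 = q ^ 2 := by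
      rw [← ht]
      linear_combination (A ^ 2 + 1) * hs + (A ^ 2 + 1) * hab + q * hA
    rcases eq_or_ne t 0 with rfl | ht0
    · left
      have ha : a = s * A := by linear_combination ht
      have : q * b ^ 2 = q * 1 := by
        rw [mul_one, ← hs]
        nth_rewrite 1 [← hA]
        rw [← hab, ← hs, ha]
        ring
      have hb := mul_left_cancel₀ hq0.ne' this
      exact ⟨by rw [ha, mul_pow, hs, hb, one_mul], hb⟩
    · right
      have h1 : 1 ≤ t ^ 2 := by
        have := sq_pos_of_ne_zero ht0
        omega
      have h2 : (a * A + s) ^ 2 = 0 := by nlinarith [sq_nonneg (a * A + s), sq_nonneg q]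
      have h3 : s = -(a * A) := by linear_combination pow_eq_zero_iff two_ne_zero |>.mp h2
      have : q * a ^ 2 = q * 1 := by
        rw [mul_one]
        nth_rewrite 1 [← hA]
        rw [← hab, ← hs, h3]
        ring
      have ha := mul_left_cancel₀ hq0.ne' this
      exact ⟨ha, by rw [← hs, h3, neg_sq, mul_pow, ha, one_mul]⟩
  rcases hcases with h1 | h1
  · exact main b h1 rfl
  · exact main (-b) (by simpa using h1) (neg_sq b)

/-! ### The quartic character, its sum E, and the signed Paley matrix -/

section QuarticCharacter

variable {F : Type*} [Field F] [Fintype F] [DecidableEq F]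

theorem exists_quartic_mulChar {k : ℕ} (hk : 0 < k) (hcard : Fintype.card F = 4 * k + 1)
    (hF : ringChar F ≠ 2) :
    ∃ (ψ : MulChar F GaussianInt) (φ : GaussianInt →+* F),
      (∀ x, ψ x ^ 2 = ((quadraticChar F x : ℤ) : GaussianInt)) ∧
      ∀ x, φ (ψ x) = x ^ (3 * k) := by
  obtain ⟨γ, hγ⟩ := IsCyclic.exists_generator (α := Fˣ)
  have hχ : quadraticChar F (γ : F) = -1 := by
    refine (quadraticChar_dichotomy γ.ne_zero).resolve_left fun h => quadraticChar_ne_one hF ?_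
    rw [MulChar.eq_iff hγ, h, MulChar.one_apply_coe]
  have hI : (⟨0, 1⟩ : GaussianInt) * ⟨0, 1⟩ = -1 := by decide
  let ζ : GaussianIntˣ := ⟨⟨0, 1⟩, ⟨0, -1⟩, by decide, by decide⟩
  have hζ : ζ ∈ rootsOfUnity (Fintype.card Fˣ) GaussianInt := by
    rw [mem_rootsOfUnity, Fintype.card_units, hcard, Nat.add_sub_cancel, pow_mul,
      show ζ ^ 4 = 1 by ext1; decide, one_pow]
  have hj : (γ : F) ^ (3 * k) * (γ : F) ^ (3 * k) = ((-1 : ℤ) : F) := by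
    have h1 := quadraticChar_eq_pow_of_char_ne_two' hF (γ : F)
    rw [hχ, hcard, show (4 * k + 1) / 2 = 2 * k by omega] at h1
    have h2 := FiniteField.pow_card_sub_one_eq_one (γ : F) γ.ne_zero
    rw [hcard, Nat.add_sub_cancel] at h2
    rw [h1, ← pow_add, show 3 * k + 3 * k = 4 * k + 2 * k by ring, pow_add, h2, one_mul]
  let ψ : MulChar F GaussianInt := MulChar.ofRootOfUnity hζ hγ
  have hψγ : ψ (γ : F) = ⟨0, 1⟩ := MulChar.ofRootOfUnity_spec hζ hγ
  -- Sending `i` to `γ^(3k)` rather than `γ^k` matters: with exponent `k` the later power sum has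
  -- degree `2k < q - 1` and vanishes.
  refine ⟨ψ, Zsqrtd.lift ⟨(γ : F) ^ (3 * k), hj⟩, fun x => ?_, fun x => ?_⟩
  · have : ψ ^ 2 = (quadraticChar F).ringHomComp (Int.castRingHom GaussianInt) := by
      rw [MulChar.eq_iff hγ, MulChar.pow_apply_coe, hψγ, MulChar.ringHomComp_apply, hχ, pow_two,
        hI]
      simp
    rw [← MulChar.pow_apply' ψ two_ne_zero, this]
    rfl
  · rcases eq_or_ne x 0 with rfl | hx
    · rw [MulChar.map_zero, map_zero, zero_pow (by omega)]
    · obtain ⟨n, hn⟩ := (mem_powers_iff_mem_zpowers.mpr (hγ (Units.mk0 x hx)))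
      have hxn : x = (γ : F) ^ n := by
        have := congrArg Units.val hn
        simpa using this.symm
      rw [hxn, map_pow, hψγ, map_pow, pow_right_comm]
      congr 1
      simp [Zsqrtd.lift]

omit [DecidableEq F] in
theorem not_dvd_normFormSum {p r k : ℕ} [Fact p.Prime] [CharP F p] (hp4 : p % 4 = 1)
    (hr : Fintype.card F = p ^ r) (hk : 0 < k) (hcard : Fintype.card F = 4 * k + 1)
    {ψ : MulChar F GaussianInt} {φ : GaussianInt →+* F} (hφ : ∀ x, φ (ψ x) = x ^ (3 * k))
    {g : F} (hg : g ≠ 0) :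
    ¬ ((p : ℤ) ∣ (normFormSum ψ g).re ∧ (p : ℤ) ∣ (normFormSum ψ g).im) := by
  rw [← Zsqrtd.intCast_dvd]
  rintro ⟨z, hz⟩
  have h0 : φ (normFormSum ψ g) = 0 := by
    rw [hz, map_mul, map_intCast, Int.cast_natCast, CharP.cast_eq_zero, zero_mul]
  rw [normFormSum, map_sum] at h0
  simp_rw [hφ, sub_eq_add_neg] at h0
  rw [sum_sq_add_pow_eq hk hcard, neg_eq_zero, mul_eq_zero] at h0
  rcases h0 with h0 | h0
  · exact neg_ne_zero.mpr hg (pow_eq_zero_iff hk.ne' |>.mp h0)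
  · rw [CharP.cast_eq_zero_iff F p] at h0
    have hkr : k = (p ^ r - 1) / 4 := by omega
    rw [hkr] at h0
    exact not_dvd_choose_three_mul_sub_one_div_four Fact.out hp4 r h0

/-- The quartic character evaluated on the binary form `x ^ 2 - g y ^ 2`, as a function on the
projective line. -/
def normFormChar (ψ : MulChar F GaussianInt) (g : F) : Option F → GaussianInt
  | none => 1
  | some c => ψ (c ^ 2 - g)

theorem norm_normFormChar {ψ : MulChar F GaussianInt}
    (hψ : ∀ x, ψ x ^ 2 = ((quadraticChar F x : ℤ) : GaussianInt)) {g : F} (hg : ¬ IsSquare g)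
    (i : Option F) : (normFormChar ψ g i).norm = 1 := by
  rcases i with _ | c
  · simp [normFormChar]
  · have h : (ψ (c ^ 2 - g)) ^ 4 = 1 := by
      rw [show 4 = 2 * 2 from rfl, pow_mul, hψ, ← Int.cast_pow,
        quadraticChar_sq_one (sq_sub_ne_zero hg c), Int.cast_one]
    have h' := congrArg Zsqrtd.normMonoidHom h
    rw [map_pow, map_one] at h'
    exact (pow_eq_one_iff_of_nonneg (GaussianInt.norm_nonneg _) four_ne_zero).mp h'

theorem norm_normFormChar_pow {ψ : MulChar F GaussianInt}
    (hψ : ∀ x, ψ x ^ 2 = ((quadraticChar F x : ℤ) : GaussianInt)) {g : F} (hg : ¬ IsSquare g)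
    (i : Option F) (n : ℕ) : (normFormChar ψ g i ^ n).norm = 1 := by
  have h := map_pow Zsqrtd.normMonoidHom (normFormChar ψ g i) n
  exact h.trans ((congrArg (· ^ n) (norm_normFormChar hψ hg i)).trans (one_pow n))

theorem sum_paleyConference_mul_normFormChar {ψ : MulChar F GaussianInt}
    (hψ : ∀ x, ψ x ^ 2 = ((quadraticChar F x : ℤ) : GaussianInt)) {g : F} (hg : ¬ IsSquare g)
    (i : Option F) :
    ∑ j, ((paleyConference F i j : ℤ) : GaussianInt) * normFormChar ψ g j =
      normFormChar ψ g i ^ 3 * normFormSum ψ g := by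
  rcases i with _ | c
  · simp [Fintype.sum_option, paleyConference, normFormChar, normFormSum]
  · rw [Fintype.sum_option]
    simpa only [paleyConference, normFormChar, Int.cast_one, one_mul] using
      one_add_sum_quadraticChar_mul hψ hg c


theorem mulVec_paleyConference_normFormChar {ψ : MulChar F GaussianInt}
    (hψ : ∀ x, ψ x ^ 2 = ((quadraticChar F x : ℤ) : GaussianInt)) {g : F} (hg : ¬ IsSquare g)
    (i : Option F) :
    (paleyConference F).mulVec (fun j => (normFormChar ψ g j).re) i =
        (normFormChar ψ g i ^ 3 * normFormSum ψ g).re ∧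
      (paleyConference F).mulVec (fun j => (normFormChar ψ g j).im) i =
        (normFormChar ψ g i ^ 3 * normFormSum ψ g).im := by
  let re : GaussianInt →+ ℤ := ⟨⟨Zsqrtd.re, rfl⟩, fun _ _ => rfl⟩
  let im : GaussianInt →+ ℤ := ⟨⟨Zsqrtd.im, rfl⟩, fun _ _ => rfl⟩
  rw [← sum_paleyConference_mul_normFormChar hψ hg i]
  refine ⟨Eq.trans ?_ (map_sum re _ _).symm, Eq.trans ?_ (map_sum im _ _).symm⟩
  · exact Finset.sum_congr rfl fun j _ => (Zsqrtd.re_smul _ _).symm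
  · exact Finset.sum_congr rfl fun j _ => (Zsqrtd.im_smul _ _).symm

/-- `C` multiplies squared lengths by `q`; every entry of `v` has norm 1 and every entry of `C v`
has the norm of `E`. -/
theorem norm_normFormSum (hF : ringChar F ≠ 2) {ψ : MulChar F GaussianInt}
    (hψ : ∀ x, ψ x ^ 2 = ((quadraticChar F x : ℤ) : GaussianInt)) {g : F} (hg : ¬ IsSquare g) :
    (normFormSum ψ g).norm = Fintype.card F := by
  have hC := transpose_mul_self_of_mul_transpose
    (Nat.cast_ne_zero.mpr Fintype.card_ne_zero) (paleyConference_mul_transpose hF)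
  have hre := sum_sq_mulVec_of_transpose_mul hC (fun j => (normFormChar ψ g j).re)
  have him := sum_sq_mulVec_of_transpose_mul hC (fun j => (normFormChar ψ g j).im)
  have hnorm : ∀ z : GaussianInt, z.re ^ 2 + z.im ^ 2 = z.norm := fun z => by
    rw [Zsqrtd.norm_def]; ring
  have hmul : ∀ i, (normFormChar ψ g i ^ 3 * normFormSum ψ g).norm = (normFormSum ψ g).norm :=
    fun i => by
      rw [Zsqrtd.norm_mul, norm_normFormChar_pow hψ hg, one_mul]
  have h := congrArg₂ (· + ·) hre him
  simp only [(mulVec_paleyConference_normFormChar hψ hg _).1,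
    (mulVec_paleyConference_normFormChar hψ hg _).2, ← mul_add, ← Finset.sum_add_distrib, hnorm,
    hmul, norm_normFormChar hψ hg, mul_one, Finset.sum_const, Finset.card_univ, nsmul_eq_mul] at h
  rw [mul_comm] at h
  exact mul_right_cancel₀ (Nat.cast_ne_zero.mpr Fintype.card_ne_zero) h

theorem re_im_cases_of_norm_eq_one {z : GaussianInt} (h : z.norm = 1) :
    (z.im = 0 ∧ (z.re = 1 ∨ z.re = -1)) ∨ (z.re = 0 ∧ (z.im = 1 ∨ z.im = -1)) := by
  rw [Zsqrtd.norm_def] at h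
  have hr : z.re ^ 2 ≤ 1 := by nlinarith [sq_nonneg z.im]
  have hi : z.im ^ 2 ≤ 1 := by nlinarith [sq_nonneg z.re]
  have h1 := abs_le_of_sq_le_sq' (a := z.re) (b := 1) (by rw [one_pow]; exact hr) zero_le_one
  have h2 := abs_le_of_sq_le_sq' (a := z.im) (b := 1) (by rw [one_pow]; exact hi) zero_le_one
  obtain ⟨a, b⟩ := z
  simp only at *
  obtain ⟨h11, h12⟩ := h1
  obtain ⟨h21, h22⟩ := h2
  interval_cases a <;> interval_cases b <;> simp_all

/-- A unit only permutes the coordinates up to sign; `s` is the sign that makes the `A` term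
positive. -/
theorem re_add_im_unit_mul {u E : GaussianInt} (hu : u.norm = 1) {A : ℤ}
    (hE : (E.re ^ 2 = A ^ 2 ∧ E.im ^ 2 = 1) ∨ (E.re ^ 2 = 1 ∧ E.im ^ 2 = A ^ 2)) :
    ∃ s t : ℤ, (s = 1 ∨ s = -1) ∧ (t = 1 ∨ t = -1) ∧
      s * ((u * E).re + (u * E).im) = A + t := by
  rw [Zsqrtd.re_mul, Zsqrtd.im_mul]
  have hone : ∀ z : ℤ, z ^ 2 = 1 ↔ z = 1 ∨ z = -1 := fun z => by
    rw [← sq_eq_sq_iff_eq_or_eq_neg, one_pow]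
  simp only [sq_eq_sq_iff_eq_or_eq_neg, hone] at hE
  rcases re_im_cases_of_norm_eq_one hu with ⟨h1, h2 | h2⟩ | ⟨h1, h2 | h2⟩ <;>
  rcases hE with ⟨h3 | h3, h4 | h4⟩ | ⟨h3 | h3, h4 | h4⟩ <;>
  rw [h1, h2, h3, h4]
  all_goals first
    | exact ⟨1, 1, by simp, by simp, by ring1⟩
    | exact ⟨1, -1, by simp, by simp, by ring1⟩
    | exact ⟨-1, 1, by simp, by simp, by ring1⟩
    | exact ⟨-1, -1, by simp, by simp, by ring1⟩

theorem exists_conference_matrix_mulVec_one {p r m : ℕ} [Fact p.Prime] [CharP F p]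
    (hp4 : p % 4 = 1) (hr : Fintype.card F = p ^ r) (hm : 0 < m)
    (hcard : Fintype.card F = 4 * m ^ 2 + 1) :
    ∃ A : Matrix (Option F) (Option F) ℤ, (∀ i j, A i j = 0 ∨ A i j = 1 ∨ A i j = -1) ∧
      (∀ i, A i i = 0) ∧ A * A.transpose = (Fintype.card F : ℤ) • (1 : Matrix _ _ ℤ) ∧
      ∀ i, ∑ j, A i j = 2 * m - 1 ∨ ∑ j, A i j = 2 * m + 1 := by
  have hp2 : p ≠ 2 := by rintro rfl; omega
  have hF : ringChar F ≠ 2 := by rwa [ringChar.eq F p]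
  have hk : 0 < m ^ 2 := by positivity
  obtain ⟨g, hg⟩ := FiniteField.exists_nonsquare hF
  have hg0 : g ≠ 0 := by rintro rfl; exact hg ⟨0, by simp⟩
  obtain ⟨ψ, φ, hψ, hφ⟩ := exists_quartic_mulChar hk hcard hF
  have hE : ((normFormSum ψ g).re ^ 2 = (2 * m : ℤ) ^ 2 ∧ (normFormSum ψ g).im ^ 2 = 1) ∨
      ((normFormSum ψ g).re ^ 2 = 1 ∧ (normFormSum ψ g).im ^ 2 = (2 * m : ℤ) ^ 2) := by
    refine eq_of_sq_add_sq_eq_prime_pow (r := r) Fact.out hp2 ?_ ?_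
      (not_dvd_normFormSum hp4 hr hk hcard hφ hg0)
    · rw [← Nat.cast_pow, ← hr, hcard]
      push_cast
      ring
    · rw [← Nat.cast_pow, ← hr, ← norm_normFormSum hF hψ hg, Zsqrtd.norm_def]
      ring
  have hu : ∀ i, (normFormChar ψ g i ^ 3).norm = 1 := fun i =>
    norm_normFormChar_pow hψ hg i 3
  choose x t hx ht hxt using fun i => re_add_im_unit_mul (hu i) hE
  let y : Option F → ℤ := fun j => (normFormChar ψ g j).re + (normFormChar ψ g j).im
  have hy : ∀ j, y j = 1 ∨ y j = -1 := fun j => by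
    rcases re_im_cases_of_norm_eq_one (norm_normFormChar hψ hg j) with ⟨h1, h2⟩ | ⟨h1, h2⟩
    · simpa [y, h1] using h2
    · simpa [y, h1] using h2
  refine ⟨Matrix.of fun i j => x i * paleyConference F i j * y j, fun i j => ?_, fun i => ?_, ?_, fun i => ?_⟩
  · rcases hx i with h1 | h1 <;> rcases hy j with h2 | h2 <;>
      rcases paleyConference_entries i j with h3 | h3 | h3 <;> simp [h1, h2, h3]
  · simp [paleyConference_diag]
  · ext i j
    have h := congrFun (congrFun (paleyConference_mul_transpose hF) i) j
    rw [Matrix.mul_apply] at h ⊢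
    have h2 : ∀ e, x i * paleyConference F i e * y e * (x j * paleyConference F j e * y e) =
        x i * x j * (paleyConference F i e * paleyConference F j e) := fun e => by
      have : y e ^ 2 = 1 := by rcases hy e with h' | h' <;> rw [h'] <;> rfl
      linear_combination x i * x j * (paleyConference F i e * paleyConference F j e) * this
    simp only [Matrix.transpose_apply, Matrix.of_apply] at h ⊢
    rw [Finset.sum_congr rfl fun e _ => h2 e, ← Finset.mul_sum, h]
    rcases eq_or_ne i j with rfl | hij
    · rcases hx i with h1 | h1 <;> simp [h1]
    · simp [hij]
  · have hrow : ∑ j, x i * paleyConference F i j * y j = 2 * m + t i := by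
      rw [← hxt i, ← (mulVec_paleyConference_normFormChar hψ hg i).1,
        ← (mulVec_paleyConference_normFormChar hψ hg i).2]
      simp only [Matrix.mulVec, dotProduct, ← Finset.sum_add_distrib, Finset.mul_sum, y]
      exact Finset.sum_congr rfl fun j _ => by ring
    simp only [Matrix.of_apply, hrow]
    rcases ht i with h | h
    · exact Or.inr (by rw [h])
    · exact Or.inl (by rw [h]; ring)

end QuarticCharacter

/-! ### Row sums and excess of conference matrices -/

namespace IsConferenceMatrix

variable {n : ℕ} {V : Matrix (Fin n) (Fin n) ℤ}

theorem sum_sq_row_sum (hV : IsConferenceMatrix V) (hn : 2 ≤ n) :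
    ∑ i, (∑ j, V i j) ^ 2 = ((n : ℤ) - 1) * n := by
  have h := sum_sq_mulVec_of_transpose_mul
    (transpose_mul_self_of_mul_transpose (by omega) hV.mul_transpose) (fun _ => 1)
  simpa [Matrix.mulVec, dotProduct] using h

theorem odd_row_sum (hV : IsConferenceMatrix V) (hn : Even n) (i : Fin n) :
    Odd (∑ j, V i j) := by
  have h := congrFun (congrFun hV.mul_transpose i) i
  simp only [Matrix.mul_apply, Matrix.transpose_apply, Matrix.smul_apply, Matrix.one_apply_eq,
    smul_eq_mul, mul_one] at h
  have heven : Even (∑ j, (V i j * V i j - V i j)) :=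
    Finset.even_sum _ fun j _ => by
      rw [← mul_sub_one]
      exact Int.even_mul_pred_self _
  rw [Finset.sum_sub_distrib, h] at heven
  have hn' : Even (n : ℤ) := by exact_mod_cast hn
  have := (hn'.sub_odd odd_one).sub_even heven
  simpa using this

theorem excess_le {m : ℕ} (hV : IsConferenceMatrix V) (hm : 0 < m) (hn : n = 4 * m ^ 2 + 2) :
    excess V ≤ 2 * m * n := by
  have hodd := hV.odd_row_sum (by rw [hn]; exact ⟨2 * m ^ 2 + 1, by ring⟩)
  have hsq := hV.sum_sq_row_sum (by omega)
  have hpos : 0 ≤ ∑ i, ((∑ j, V i j - 2 * m) ^ 2 - 1) := Finset.sum_nonneg fun i _ => by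
    -- An odd integer differs from `2m`.
    have : (∑ j, V i j) - 2 * (m : ℤ) ≠ 0 := by
      obtain ⟨s, hs⟩ := hodd i
      omega
    have := sq_pos_of_ne_zero this
    omega
  have hexp : ∀ i, (∑ j, V i j - 2 * (m : ℤ)) ^ 2 - 1 =
      (∑ j, V i j) ^ 2 - 4 * m * ∑ j, V i j + (4 * m ^ 2 - 1) := fun i => by ring
  simp only [hexp, Finset.sum_add_distrib, Finset.sum_sub_distrib, ← Finset.mul_sum, hsq,
    Finset.sum_const, Finset.card_univ, Fintype.card_fin, nsmul_eq_mul] at hpos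
  rw [show ∑ i, ∑ j, V i j = excess V from rfl] at hpos
  have hn' : (n : ℤ) = 4 * m ^ 2 + 2 := by exact_mod_cast hn
  have h4 : (0 : ℤ) < 4 * m := by positivity
  refine le_of_mul_le_mul_left ?_ h4
  have : ((n : ℤ) - 1) * n + n * (4 * m ^ 2 - 1) = 4 * m * (2 * m * n) := by rw [hn']; ring
  linarith

theorem excess_eq_of_row_sums {m : ℕ} (hV : IsConferenceMatrix V) (hm : 0 < m)
    (hn : n = 4 * m ^ 2 + 2)
    (hrow : ∀ i, ∑ j, V i j = 2 * m - 1 ∨ ∑ j, V i j = 2 * m + 1) :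
    excess V = 2 * m * n := by
  have hsq := hV.sum_sq_row_sum (by omega)
  have hexp : ∀ i, (∑ j, V i j) ^ 2 = 4 * m * ∑ j, V i j - (4 * m ^ 2 - 1) := fun i => by
    rcases hrow i with h | h <;> rw [h] <;> ring
  simp only [hexp, Finset.sum_sub_distrib, ← Finset.mul_sum,
    Finset.sum_const, Finset.card_univ, Fintype.card_fin, nsmul_eq_mul] at hsq
  rw [show ∑ i, ∑ j, V i j = excess V from rfl] at hsq
  have hn' : (n : ℤ) = 4 * m ^ 2 + 2 := by exact_mod_cast hn
  have h4 : (4 * m : ℤ) ≠ 0 := by positivity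
  refine mul_left_cancel₀ h4 ?_
  have : ((n : ℤ) - 1) * n + n * (4 * m ^ 2 - 1) = 4 * m * (2 * m * n) := by rw [hn']; ring
  linarith

/-- The mean row sum is `2m`, so neither `2m - 1` nor `2m + 1` can be the only value. -/
theorem range_row_sums {m : ℕ} (hV : IsConferenceMatrix V) (hm : 0 < m)
    (hn : n = 4 * m ^ 2 + 2)
    (hrow : ∀ i, ∑ j, V i j = 2 * m - 1 ∨ ∑ j, V i j = 2 * m + 1) :
    (Set.range fun i => ∑ j, V i j) = {2 * (m : ℤ) - 1, 2 * (m : ℤ) + 1} := by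
  have hexc : ∑ i, ∑ j, V i j = 2 * (m : ℤ) * n := hV.excess_eq_of_row_sums hm hn hrow
  have hn0 : (n : ℤ) ≠ 0 := by rw [hn]; positivity
  have hconst : ∀ c : ℤ, (∀ i, ∑ j, V i j = c) → c = 2 * m := fun c hc => by
    rw [Finset.sum_congr rfl fun i _ => hc i, Finset.sum_const, Finset.card_univ,
      Fintype.card_fin, nsmul_eq_mul, mul_comm] at hexc
    exact mul_right_cancel₀ hn0 hexc
  apply Set.Subset.antisymm
  · rintro _ ⟨i, rfl⟩
    exact hrow i
  · rintro c (rfl | rfl)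
    · by_contra h
      have := hconst _ fun i => (hrow i).resolve_left fun hi => h ⟨i, hi⟩
      omega
    · by_contra h
      have := hconst _ fun i => (hrow i).resolve_right fun hi => h ⟨i, hi⟩
      omega

end IsConferenceMatrix

/-! ### Assembly over the Galois field -/

theorem theorem1p2 (p r q m : ℕ) (hp : p.Prime) (hp4 : p % 4 = 1) (hr : 0 < r)
    (hq : q = p ^ r) (hqm : q = 4 * m ^ 2 + 1) :
    ¬ IsSquare q ∧
    ∃ W : Matrix (Fin (q + 1)) (Fin (q + 1)) ℤ, IsConferenceMatrix W ∧
      -- the excess is maximum among all conference matrices of the same order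
      (∀ V : Matrix (Fin (q + 1)) (Fin (q + 1)) ℤ, IsConferenceMatrix V →
        excess V ≤ excess W) ∧
      -- and equals the bound `n (k² + 2k + n - 1) / (2 (k + 1))` with `n = q + 1`, where
      -- `k` is the odd integer with `k ≤ √(n - 1) < k + 2`
      (∃ k : ℤ, Odd k ∧ (k : ℝ) ≤ √(q : ℝ) ∧ √(q : ℝ) < (k : ℝ) + 2 ∧
        (excess W : ℝ) =
          ((q : ℝ) + 1) * ((k : ℝ) ^ 2 + 2 * (k : ℝ) + (q : ℝ)) / (2 * ((k : ℝ) + 1))) ∧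
      -- the entries of `W 1` are exactly the two numbers `2m - 1` and `2m + 1`
      Set.range (W.mulVec (fun _ => (1 : ℤ))) = {2 * (m : ℤ) - 1, 2 * (m : ℤ) + 1} := by
  have hm : 0 < m := by
    rcases Nat.eq_zero_or_pos m with rfl | h
    · have := Nat.one_lt_pow hr.ne' hp.one_lt
      omega
    · exact h
  have hn : q + 1 = 4 * m ^ 2 + 2 := by omega
  refine ⟨?_, ?_⟩
  · rintro ⟨s, hs⟩
    have h1 : 2 * m < s := by by_contra h; nlinarith
    have h2 : s < 2 * m + 1 := by by_contra h; nlinarith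
    omega
  have : Fact p.Prime := ⟨hp⟩
  let F := GaloisField p r
  have : Fintype F := Fintype.ofFinite F
  classical
  have hF : Fintype.card F = p ^ r := by
    rw [Fintype.card_eq_nat_card, GaloisField.card p r hr.ne']
  obtain ⟨A, hentries, hdiag, hmul, hrow⟩ :=
    exists_conference_matrix_mulVec_one (F := F) hp4 hF hm (by omega)
  let e : Fin (q + 1) ≃ Option F := Fintype.equivOfCardEq (by simp [hF, hq])
  have hW : IsConferenceMatrix (A.submatrix e e) := by
    refine ⟨fun i j => hentries _ _, fun i => hdiag _, ?_⟩
    rw [Matrix.transpose_submatrix, Matrix.submatrix_mul_equiv, hmul, hF, ← hq]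
    ext i j
    simp only [Matrix.submatrix_apply, Matrix.smul_apply, Matrix.one_apply, e.apply_eq_iff_eq]
    simp
  have hWrow : ∀ i, ∑ j, A.submatrix e e i j = 2 * m - 1 ∨
      ∑ j, A.submatrix e e i j = 2 * m + 1 := fun i => by
    have : ∑ j, A.submatrix e e i j = ∑ j, A (e i) j := Equiv.sum_comp e (A (e i))
    rw [this]
    exact hrow (e i)
  have hexc := hW.excess_eq_of_row_sums hm hn hWrow
  -- Since `(2m - 1)² ≤ 4m² + 1 < (2m + 1)²`, the odd integer is `k = 2m - 1`, and the formula
  -- collapses to `2mn`.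
  refine ⟨A.submatrix e e, hW, fun V hV => hexc ▸ hV.excess_le hm hn,
    ⟨2 * m - 1, ⟨m - 1, by ring⟩, ?_, ?_, ?_⟩, ?_⟩
  · apply Real.le_sqrt_of_sq_le
    rw [hqm]
    push_cast
    have : (1 : ℝ) ≤ m := by exact_mod_cast hm
    nlinarith
  · rw [Real.sqrt_lt' (by push_cast; have : (1 : ℝ) ≤ m := by exact_mod_cast hm
                          linarith), hqm]
    push_cast
    have : (1 : ℝ) ≤ m := by exact_mod_cast hm
    nlinarith
  · rw [hexc, hqm]
    push_cast
    have : (m : ℝ) ≠ 0 := by exact_mod_cast hm.ne'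
    have h2 : (2 * ((2 * m - 1 : ℝ) + 1)) ≠ 0 := by
      ring_nf
      positivity
    rw [eq_div_iff h2]
    ring
  · rw [← hW.range_row_sums hm hn hWrow]
    congr 1
    ext i
    simp [Matrix.mulVec, dotProduct]
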